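/- Let $L$ be a first-order language and let $\mathcal{M}$ be an ultrahomogeneous $L$-structure (every isomorphism between finitely generated substructures of $\mathcal{M}$ extends to an automorphism of $\mathcal{M}$); neither $L$ nor $\mathcal{M}$ is assumed to be countable, and $\mathcal{M}$ is not assumed to be locally finite. Let $\mathrm{Age}(\mathcal{M})$ be the class of finitely generated $L$-structures that embed into $\mathcal{M}$, and equip $\mathrm{Aut}(\mathcal{M})$ with the topology of pointwise convergence ($\mathcal{M}$ being discrete). Then the following are equivalent: \begin{enumerate} \item $\mathrm{Aut}(\mathcal{M})$ is extremely amenable, i.e. every continuous action of $\mathrm{Aut}(\mathcal{M})$ on a nonempty compact Hausdorff space has a fixed point. \item $\mathcal{M}$ has the finitary Embedding Ramsey Property, i.e. the class $\mathcal{C}=\mathrm{Age}(\mathcal{M})$ has it: for all $M\in\mathcal{C}$ and all finite subsets $A,B\subseteq M$ there are $N\in\mathcal{C}$ and a finite subset $C\subseteq N$ such that $C\to(B)^A_2$. \item $\mathrm{Age}(\mathcal{M})$ is a finitary Ramsey class, i.e. it has the hereditary property (closure under finitely generated structures that embed into a member), the joint embedding property and the finitary Embedding Ramsey Property. \end{enumerate}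 Here, for $L$-structures $M,N$, a finite subset $A\subseteq M$ and a subset $C\subseteq N$, a copy of $A$ in $C$ is a map $f:A\to C$ such that the tuples $(f(a))_{a\in A}$ in $N$ and $(a)_{a\in A}$ in $M$ have the same quantifier-free type; $\binom{C}{A}$ is the set of these copies; and $C\to(B)^A_2$ means that for every colouring $\chi:\binom{C}{A}\to\{0,1\}$ there is $g\in\binom{C}{B}$ such that $\chi$ is constant on $\binom{g(B)}{A}$. -/

import Mathlib

universe u v w x

namespace FiniteRamsey

open FirstOrder FirstOrder.Language

/-! ### Automorphism groups and extreme amenability -/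

section Aut

variable (L : FirstOrder.Language.{u, v}) (M : Type w) [L.Structure M]

/-- The automorphisms of a first-order structure. -/
abbrev Aut : Type w := M ≃[L] M

/-- Automorphisms form a group under composition: `(g * h) m = g (h m)`. -/
instance autGroup : Group (Aut L M) where
  mul g h := FirstOrder.Language.Equiv.comp g h
  one := FirstOrder.Language.Equiv.refl L M
  inv g := FirstOrder.Language.Equiv.symm g
  mul_assoc _ _ _ := DFunLike.coe_injective rfl
  one_mul _ := DFunLike.coe_injective rfl
  mul_one _ := DFunLike.coe_injective rfl
  inv_mul_cancel g := FirstOrder.Language.Equiv.symm_comp_self g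

/-- The topology of pointwise convergence on the automorphism group, where the structure itself
is regarded as a discrete space. -/
instance autTopology : TopologicalSpace (Aut L M) :=
  TopologicalSpace.induced (fun (g : Aut L M) (m : M) => g m)
    (@Pi.topologicalSpace M (fun _ => M) (fun _ => ⊥))

instance autIsTopologicalGroup : IsTopologicalGroup (Aut L M) := by
  let _ : TopologicalSpace M := ⊥
  have _ : DiscreteTopology M := ⟨rfl⟩
  have hev : ∀ m : M, Continuous fun g : Aut L M => g m := fun m =>
    (continuous_apply m).comp continuous_induced_dom
  refine { continuous_mul := ?_, continuous_inv := ?_ }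
  · refine continuous_induced_rng.2 (continuous_pi fun m => ?_)
    refine continuous_discrete_rng.2 fun b => ?_
    refine isOpen_iff_mem_nhds.2 fun p hp => ?_
    have h1 : ∀ᶠ q : Aut L M × Aut L M in nhds p, q.2 m = p.2 m :=
      ((hev m).comp continuous_snd).continuousAt.eventually
        ((isOpen_discrete {p.2 m}).mem_nhds rfl)
    have h2 : ∀ᶠ q : Aut L M × Aut L M in nhds p, q.1 (p.2 m) = p.1 (p.2 m) :=
      ((hev (p.2 m)).comp continuous_fst).continuousAt.eventually
        ((isOpen_discrete {p.1 (p.2 m)}).mem_nhds rfl)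
    filter_upwards [h1, h2] with q hq1 hq2
    change q.1 (q.2 m) = b
    rw [hq1, hq2]
    exact hp
  · refine continuous_induced_rng.2 (continuous_pi fun m => ?_)
    refine continuous_discrete_rng.2 fun b => ?_
    have h : (fun g : Aut L M => (g⁻¹ : Aut L M) m) ⁻¹' {b} = (fun g : Aut L M => g b) ⁻¹' {m} := by
      ext g
      change g.symm m = b ↔ g b = m
      constructor
      · rintro rfl
        exact g.apply_symm_apply m
      · rintro rfl
        exact g.symm_apply_apply b
    change IsOpen ((fun g : Aut L M => (g⁻¹ : Aut L M) m) ⁻¹' {b})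
    rw [h]
    exact (isOpen_discrete {m}).preimage (hev b)

end Aut

/-- A topological group `G` is extremely amenable if every continuous action of `G` on a nonempty
compact Hausdorff space has a fixed point. (The spaces range over a universe
at least as large as that of `G`.) -/
def IsExtremelyAmenable (G : Type w) [Group G] [TopologicalSpace G] : Prop :=
  ∀ (X : Type (max w x)) [TopologicalSpace X] [CompactSpace X] [T2Space X] [Nonempty X]
    [MulAction G X] [ContinuousSMul G X], ∃ p : X, ∀ g : G, g • p = p

/-! ### Quantifier-free types and the partition arrow for finite sets -/

section Arrow

variable {L : FirstOrder.Language.{u, v}} {M N : Type w} [L.Structure M] [L.Structure N]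

/-- The complete quantifier-free type (over the empty set) of a tuple indexed by `α`. -/
def qfType {α : Type w} (a : α → M) : Set (L.Formula α) :=
  {φ | φ.IsQF ∧ φ.Realize a}

variable (L)

/-- The copies in `C ⊆ N` of a set `A ⊆ M`: the tuples from `C`, indexed by the elements of `A`,
with the same quantifier-free type as `A` (enumerated by itself). -/
def copies (A : Set M) (C : Set N) : Set (A → N) :=
  {f | (∀ a, f a ∈ C) ∧ qfType (L := L) f = qfType (L := L) (fun a : A => (a : M))}

/-- The partition arrow `C → (B)^A_r`: for every colouring with `r` colours of the copies of `A`
in `C` there is a copy of `B` in `C` such that all copies of `A` inside it have the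
same colour. -/
def Arrows (C : Set N) (A B : Set M) (r : ℕ) : Prop :=
  ∀ χ : copies L A C → Fin r, ∃ g ∈ copies L B C, ∀ f₁ f₂ : copies L A C,
    f₁.1 ∈ copies L A (Set.range g) → f₂.1 ∈ copies L A (Set.range g) → χ f₁ = χ f₂

end Arrow

/-! ### The finitary Embedding Ramsey Property -/

section Classes

variable {L : FirstOrder.Language.{u, v}}

/-- The finitary Embedding Ramsey Property of a class of structures. -/
def FinitaryERP (K : Set (CategoryTheory.Bundled.{w} L.Structure)) : Prop :=
  ∀ M ∈ K, ∀ A B : Set M, A.Finite → B.Finite →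
    ∃ N ∈ K, ∃ C : Set N, C.Finite ∧ Arrows L C A B 2

/-- A finitary Ramsey class: the hereditary property, the joint embedding property, and the
finitary Embedding Ramsey Property. -/
structure IsFinitaryRamseyClass (K : Set (CategoryTheory.Bundled.{w} L.Structure)) : Prop where
  hereditary : Hereditary K
  jointEmbedding : JointEmbedding K
  finitaryERP : FinitaryERP K

end Classes

end FiniteRamsey

/-!
Throughout, `G` is the automorphism group of the ultrahomogeneous structure `M`. By
ultrahomogeneity, two finite tuples of `M` have the same quantifier-free type exactly when they
lie in the same `G`-orbit (`exists_aut_of_qfType_eq`). So the copies of a finite set `A` in `M` are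
the cosets of the pointwise stabilizer of `A`, and colourings of copies of `A` are functions on
`G` which depend only on the restriction of an automorphism to `A`.

*The Ramsey property implies extreme amenability.* The Ramsey property says that such a function
with two values is constant on some left translate `h F` of any given finite set `F ⊆ G`, and that
`h` may be taken from a finite set not depending on the function
(`FinitaryERP.exists_finite_translates`). This uniformity lets one treat finitely many functions
at once (`FinitaryERP.exists_translate`). If `G` acts continuously on a nonempty compact Hausdorff
space without fixed points, then the space is covered by finitely many open sets `D`, each
invariant under the stabilizer of a finite set and each disjoint from some translate `g • D`
(`exists_stabilizer_invariant_disjoint`). For a point `p` and each of these `D`, colour `k : G`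
according to whether `k⁻¹ • p ∈ D`. A translate `h F`, with `F` containing `1` and all `g⁻¹`,
on which all these colourings are constant yields a point `h⁻¹ • p` that lies in `D` if and only
if `g • h⁻¹ • p` does, for every `D` of the cover. This is absurd.

*Extreme amenability implies the Ramsey property.* The colourings of the copies of `A` in `M` for
which no copy of `B` is monochromatic form a compact space on which `G` acts continuously. A fixed
point would be a constant colouring, since `G` is transitive on the copies of `A`, so the space is
empty. By compactness finitely many copies of `B` already exclude all colourings, and the union of
these copies, inside the substructure it generates, is the required finite set.

The remaining implications hold because the age of any structure has the hereditary and the joint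
embedding property.
-/

namespace FiniteRamsey

open FirstOrder FirstOrder.Language Topology

/-! ### Quantifier-free types and automorphisms -/

section QuantifierFree

variable {L : FirstOrder.Language.{u, v}} {M N : Type w} [L.Structure M] [L.Structure N]
  {α : Type w}

theorem qfType_comp_embedding (e : M ↪[L] N) (a : α → M) :
    qfType (L := L) (fun i => e (a i)) = qfType (L := L) a := by
  ext φ
  refine and_congr_right fun hφ => ?_
  have h := hφ.realize_embedding e (v := a) (xs := default)
  rw [Subsingleton.elim (e ∘ default) default] at h
  exact h

theorem qfType_comp_equiv (e : M ≃[L] N) (a : α → M) :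
    qfType (L := L) (fun i => e (a i)) = qfType (L := L) a :=
  qfType_comp_embedding e.toEmbedding a

theorem realize_eq_iff_of_qfType_eq {a : α → M} {b : α → N}
    (h : qfType (L := L) a = qfType (L := L) b) (s t : L.Term α) :
    s.realize a = t.realize a ↔ s.realize b = t.realize b := by
  have hqf : (s.equal t).IsQF := (BoundedFormula.IsAtomic.equal _ _).isQF
  have := Set.ext_iff.1 h (s.equal t)
  simpa [qfType, hqf, Formula.realize_equal] using this

theorem relMap_iff_of_qfType_eq {a : α → M} {b : α → N}
    (h : qfType (L := L) a = qfType (L := L) b) {n : ℕ} (R : L.Relations n)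
    (ts : Fin n → L.Term α) :
    Structure.RelMap R (fun i => (ts i).realize a) ↔
      Structure.RelMap R (fun i => (ts i).realize b) := by
  have hqf : (R.formula ts).IsQF := (BoundedFormula.IsAtomic.rel _ _).isQF
  have := Set.ext_iff.1 h (R.formula ts)
  simpa [qfType, hqf, Formula.realize_rel] using this

theorem exists_term_of_mem_closure_range (a : α → M)
    (x : Substructure.closure L (Set.range a)) : ∃ t : L.Term α, t.realize a = x := by
  obtain ⟨t, ht⟩ := Substructure.mem_closure_iff_exists_term.1 x.2
  refine ⟨t.relabel fun y => Classical.choose y.2, ?_⟩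
  rw [Term.realize_relabel, ← ht]
  congr 1
  exact funext fun y => Classical.choose_spec y.2

/-- If `a` and `b` have the same quantifier-free type, then sending `t(a)` to `t(b)`, for `t` a
term, is a well-defined embedding of the substructure generated by `a`. -/
theorem exists_embedding_of_qfType_eq {a : α → M} {b : α → N}
    (h : qfType (L := L) a = qfType (L := L) b) :
    ∃ e : Substructure.closure L (Set.range a) ↪[L] N,
      ∀ i, e ⟨a i, Substructure.subset_closure ⟨i, rfl⟩⟩ = b i := by
  choose τ hτ using exists_term_of_mem_closure_range (L := L) a
  have key : ∀ (x : Substructure.closure L (Set.range a)) (t : L.Term α),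
      t.realize a = x → (τ x).realize b = t.realize b := fun x t ht =>
    (realize_eq_iff_of_qfType_eq h _ _).1 ((hτ x).trans ht.symm)
  refine ⟨⟨⟨fun x => (τ x).realize b, fun x y hxy => ?_⟩, fun {n} f x => ?_, fun {n} R x => ?_⟩,
    fun i => key _ (Term.var i) rfl⟩
  · exact Subtype.ext ((hτ x).symm.trans
      (((realize_eq_iff_of_qfType_eq h _ _).2 hxy).trans (hτ y)))
  · refine key _ (Term.func f fun i => τ (x i)) ?_
    rw [Term.realize_func]
    simp only [hτ]
    rfl
  · refine (relMap_iff_of_qfType_eq h R fun i => τ (x i)).symm.trans ?_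
    simp only [hτ]
    rfl

/-- In an ultrahomogeneous structure, finite tuples with the same quantifier-free type are
conjugate under the automorphism group. -/
theorem exists_aut_of_qfType_eq (hM : L.IsUltrahomogeneous M) [Finite α] {a b : α → M}
    (h : qfType (L := L) a = qfType (L := L) b) : ∃ g : Aut L M, ∀ i, g (a i) = b i := by
  obtain ⟨e, he⟩ := exists_embedding_of_qfType_eq h
  obtain ⟨g, hg⟩ := hM _ (Substructure.fg_closure (Set.finite_range a)) e
  exact ⟨g, fun i => by rw [← he i, hg]; rfl⟩

theorem finite_copies {A : Set M} (hA : A.Finite) {C : Set N} (hC : C.Finite) :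
    (copies L A C).Finite := by
  have := hA.to_subtype
  exact (Set.Finite.pi' fun _ : A => hC).subset fun f hf => hf.1

theorem Aut.inv_apply_self (g : Aut L M) (m : M) : g⁻¹ (g m) = m := g.symm_apply_apply m

theorem Aut.apply_inv_self (g : Aut L M) (m : M) : g (g⁻¹ m) = m := g.apply_symm_apply m

theorem Aut.eventually_apply_eq (g : Aut L M) (m : M) : ∀ᶠ k in 𝓝 g, k m = g m := by
  let _ : TopologicalSpace M := ⊥
  have _ : DiscreteTopology M := ⟨rfl⟩
  have hev : Continuous fun g : Aut L M => g m :=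
    (continuous_apply m).comp continuous_induced_dom
  exact hev.continuousAt.eventually ((isOpen_discrete {g m}).mem_nhds rfl)

/-- The pointwise stabilizers of finite sets form a neighbourhood basis at the identity. -/
theorem Aut.exists_finite_of_mem_nhds_one {U : Set (Aut L M)} (hU : U ∈ 𝓝 (1 : Aut L M)) :
    ∃ A : Set M, A.Finite ∧ ∀ g : Aut L M, (∀ a ∈ A, g a = a) → g ∈ U := by
  let _ : TopologicalSpace M := ⊥
  rw [nhds_induced, Filter.mem_comap] at hU
  obtain ⟨V, hV, hVU⟩ := hU
  rw [nhds_pi, Filter.mem_pi] at hV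
  obtain ⟨A, hA, t, ht, htV⟩ := hV
  refine ⟨A, hA, fun g hg => hVU (htV fun a ha => ?_)⟩
  change g a ∈ t a
  rw [hg a ha]
  exact mem_of_mem_nhds (ht a)

end QuantifierFree

/-! ### The Ramsey property implies extreme amenability -/

section RamseyToAmenable

variable {L : FirstOrder.Language.{u, v}} {M : Type w} [L.Structure M]

/-- A form of the Ramsey property for the automorphism group: two-valued functions depending only
on the restriction to `A` are constant on a translate `h F`, with `h` from a fixed finite set. -/
theorem FinitaryERP.exists_finite_translates (hM : L.IsUltrahomogeneous M)
    (hR : FinitaryERP (L.age M)) {A : Set M} (hA : A.Finite) {F : Set (Aut L M)}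
    (hF : F.Finite) :
    ∃ E : Set (Aut L M), E.Finite ∧ ∀ χ : Aut L M → Fin 2,
      (∀ g k : Aut L M, (∀ a ∈ A, g a = k a) → χ g = χ k) →
      ∃ h ∈ E, ∀ f₁ ∈ F, ∀ f₂ ∈ F, χ (h * f₁) = χ (h * f₂) := by
  -- `B` contains every `f A` with `f ∈ F`, and `A` itself so that `A` lies in the structure `S`.
  let B : Set M := A ∪ ⋃ f ∈ F, (fun m => f m) '' A
  have hB : B.Finite := hA.union (hF.biUnion fun f _ => hA.image _)
  let S : L.Substructure M := Substructure.closure L B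
  have hBS : B ⊆ S := Substructure.subset_closure
  let A' : Set S := Subtype.val ⁻¹' A
  let B' : Set S := Subtype.val ⁻¹' B
  have hA' : A'.Finite := hA.preimage Subtype.val_injective.injOn
  have hB' : B'.Finite := hB.preimage Subtype.val_injective.injOn
  have _ := hA'.to_subtype
  have _ := hB'.to_subtype
  obtain ⟨N, ⟨-, ⟨e⟩⟩, C, hC, harrow⟩ :=
    hR _ (age.fg_substructure (Substructure.fg_closure hB)) A' B' hA' hB'
  have extend : ∀ (D : Set S) [Finite D] (g : copies L D C),
      ∃ k : Aut L M, ∀ d : D, k (d : S) = e (g.1 d) := fun D _ g =>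
    exists_aut_of_qfType_eq hM (((qfType_comp_embedding S.subtype _).trans g.2.2.symm).trans
      (qfType_comp_embedding e g.1).symm)
  choose κ hκ using extend B'
  choose μ hμ using extend A'
  have _ := (finite_copies (L := L) hB' hC).to_subtype
  refine ⟨Set.range κ, Set.finite_range κ, fun χ hχ => ?_⟩
  obtain ⟨g, hg, hmono⟩ := harrow fun f => χ (μ f)
  refine ⟨κ ⟨g, hg⟩, ⟨_, rfl⟩, ?_⟩
  -- For `f ∈ F`, the copy `g ∘ f` of `A` inside the copy `g` of `B`.
  have sub : ∀ f ∈ F, ∃ c : copies L A' C, c.1 ∈ copies L A' (Set.range g) ∧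
      χ (μ c) = χ (κ ⟨g, hg⟩ * f) := by
    intro f hf
    have hfB : ∀ a : A', f (a : S) ∈ B := fun a =>
      Or.inr (Set.mem_biUnion hf ⟨_, a.2, rfl⟩)
    let c : A' → N := fun a => g ⟨⟨f (a : S), hBS (hfB a)⟩, hfB a⟩
    have hec : ∀ a : A', e (c a) = (κ ⟨g, hg⟩ * f) (a : S) := fun a =>
      (hκ ⟨g, hg⟩ ⟨⟨f (a : S), hBS (hfB a)⟩, hfB a⟩).symm
    have hqf : qfType (L := L) c = qfType (L := L) fun a : A' => (a : S) := by
      rw [← qfType_comp_embedding e c]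
      simp only [hec]
      exact (qfType_comp_equiv (κ ⟨g, hg⟩ * f) _).trans (qfType_comp_embedding S.subtype _)
    have hc : c ∈ copies L A' C := ⟨fun a => hg.1 _, hqf⟩
    refine ⟨⟨c, hc⟩, ⟨fun a => ⟨_, rfl⟩, hqf⟩, hχ _ _ fun a ha => ?_⟩
    have haS : a ∈ S := hBS (Or.inl ha)
    exact (hμ ⟨c, hc⟩ ⟨⟨a, haS⟩, ha⟩).trans (hec ⟨⟨a, haS⟩, ha⟩)
  intro f₁ hf₁ f₂ hf₂
  obtain ⟨c₁, hc₁, h₁⟩ := sub f₁ hf₁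
  obtain ⟨c₂, hc₂, h₂⟩ := sub f₂ hf₂
  rw [← h₁, ← h₂]
  exact hmono c₁ c₂ hc₁ hc₂

/-- Finitely many two-valued functions depending only on the restriction to `A` are simultaneously
constant on a translate of any given finite set. -/
theorem FinitaryERP.exists_translate (hM : L.IsUltrahomogeneous M)
    (hR : FinitaryERP (L.age M)) {A : Set M} (hA : A.Finite) {ι : Type*} (s : Finset ι)
    (χ : ι → Aut L M → Fin 2)
    (hχ : ∀ i ∈ s, ∀ g k : Aut L M, (∀ a ∈ A, g a = k a) → χ i g = χ i k)
    {F : Set (Aut L M)} (hF : F.Finite) :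
    ∃ h : Aut L M, ∀ i ∈ s, ∀ f₁ ∈ F, ∀ f₂ ∈ F, χ i (h * f₁) = χ i (h * f₂) := by
  classical
  induction s using Finset.induction_on generalizing F with
  | empty => exact ⟨1, by simp⟩
  | insert j s _ ih =>
    obtain ⟨E, hE, hEF⟩ := FinitaryERP.exists_finite_translates hM hR hA hF
    -- After translating by `h`, the functions in `s` are constant on each `k F` with `k ∈ E`, so
    -- a suitable choice of `k ∈ E` handles the remaining function.
    obtain ⟨h, hh⟩ := ih (fun i hi => hχ i (Finset.mem_insert_of_mem hi))
      (hE.image2 (fun k f => k * f) hF)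
    obtain ⟨k, hk, hkF⟩ := hEF (fun g => χ j (h * g)) fun g g' hgg' =>
      hχ j (Finset.mem_insert_self j s) _ _ fun a ha => congrArg h (hgg' a ha)
    refine ⟨h * k, fun i hi f₁ hf₁ f₂ hf₂ => ?_⟩
    rw [mul_assoc, mul_assoc]
    rcases Finset.mem_insert.1 hi with rfl | hi
    · exact hkF f₁ hf₁ f₂ hf₂
    · exact hh i hi _ (Set.mem_image2_of_mem hk hf₁) _ (Set.mem_image2_of_mem hk hf₂)

/-- A point moved by the action has an open neighbourhood `D` which is invariant under the
stabilizer of a finite set and disjoint from one of its translates. -/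
theorem exists_stabilizer_invariant_disjoint {X : Type*} [TopologicalSpace X] [T2Space X]
    [MulAction (Aut L M) X] [ContinuousSMul (Aut L M) X] {p : X} {g : Aut L M}
    (hg : g • p ≠ p) :
    ∃ (D : Set X) (A : Set M), IsOpen D ∧ p ∈ D ∧ A.Finite ∧
      (∀ k : Aut L M, (∀ a ∈ A, k a = a) → ∀ y, k • y ∈ D ↔ y ∈ D) ∧
      ∀ y ∈ D, g • y ∉ D := by
  obtain ⟨V, W, hV, hW, hpV, hpW, hVW⟩ := t2_separation hg
  -- Every `y` in the open neighbourhood `W ∩ g⁻¹ V` of `p` has `g • y ∉ W`.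
  have hO : IsOpen (W ∩ (fun y => g • y) ⁻¹' V) := hW.inter (hV.preimage (continuous_const_smul g))
  have hcont : ContinuousAt (fun q : Aut L M × X => q.1 • q.2) (1, p) :=
    continuous_smul.continuousAt
  have hmem : (fun q : Aut L M × X => q.1 • q.2) ⁻¹' (W ∩ (fun y => g • y) ⁻¹' V) ∈
      𝓝 ((1 : Aut L M), p) :=
    hcont (hO.mem_nhds (by simpa using ⟨hpW, hpV⟩))
  rw [nhds_prod_eq, Filter.mem_prod_iff] at hmem
  obtain ⟨U, hU, T, hT, hUT⟩ := hmem
  obtain ⟨A, hA, hAU⟩ := Aut.exists_finite_of_mem_nhds_one hU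
  obtain ⟨T', hT'T, hT', hpT'⟩ := mem_nhds_iff.1 hT
  -- The saturation of `T'` under the stabilizer of `A`.
  let D : Set X := ⋃ (k : Aut L M) (_ : ∀ a ∈ A, k a = a), (fun y => k • y) ⁻¹' T'
  have hmemD : ∀ y, y ∈ D ↔ ∃ k : Aut L M, (∀ a ∈ A, k a = a) ∧ k • y ∈ T' := by
    intro y
    simp [D]
  have hinv : ∀ k : Aut L M, (∀ a ∈ A, k a = a) → ∀ a ∈ A, k⁻¹ a = a := fun k hk a ha => by
    conv_lhs => rw [← hk a ha]
    exact Aut.inv_apply_self k a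
  have hDO : D ⊆ W ∩ (fun y => g • y) ⁻¹' V := by
    intro y hy
    obtain ⟨k, hk, hky⟩ := (hmemD y).1 hy
    have : k⁻¹ • k • y ∈ W ∩ (fun y => g • y) ⁻¹' V :=
      hUT (Set.mk_mem_prod (hAU _ (hinv k hk)) (hT'T hky))
    rwa [inv_smul_smul] at this
  refine ⟨D, A, ?_, (hmemD p).2 ⟨1, fun _ _ => rfl, by rwa [one_smul]⟩, hA, ?_, ?_⟩
  · exact isOpen_iUnion fun k => isOpen_iUnion fun _ => hT'.preimage (continuous_const_smul k)
  · intro k hk y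
    rw [hmemD, hmemD]
    constructor
    · rintro ⟨j, hj, hjy⟩
      refine ⟨j * k, fun a ha => ?_, by rwa [mul_smul]⟩
      change j (k a) = a
      rw [hk a ha, hj a ha]
    · rintro ⟨j, hj, hjy⟩
      refine ⟨j * k⁻¹, fun a ha => ?_, by rwa [mul_smul, inv_smul_smul]⟩
      change j (k⁻¹ a) = a
      rw [hinv k hk a ha, hj a ha]
  · exact fun y hy hgy => Set.disjoint_left.1 hVW (hDO hy).2 (hDO hgy).1

theorem FinitaryERP.isExtremelyAmenable (hM : L.IsUltrahomogeneous M)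
    (hR : FinitaryERP (L.age M)) : IsExtremelyAmenable.{w, x} (Aut L M) := by
  classical
  intro X _ _ _ ⟨p⟩ _ _
  by_contra! hfix
  choose g hg using hfix
  choose D A hD hpD hA hDA hgD using fun y => exists_stabilizer_invariant_disjoint (hg y)
  obtain ⟨s, hs⟩ := isCompact_univ.elim_finite_subcover D hD
    fun y _ => Set.mem_iUnion.2 ⟨y, hpD y⟩
  obtain ⟨h, hh⟩ := FinitaryERP.exists_translate hM hR (A := ⋃ y ∈ s, A y)
    (s.finite_toSet.biUnion fun y _ => hA y) s
    (fun y k => if k⁻¹ • p ∈ D y then 1 else 0) (fun y hy k k' hkk' => by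
      have hstab : ∀ a ∈ A y, (k'⁻¹ * k) a = a := fun a ha => by
        change k'⁻¹ (k a) = a
        rw [hkk' a (Set.mem_biUnion hy ha)]
        exact Aut.inv_apply_self k' a
      have := hDA y _ hstab (k⁻¹ • p)
      rw [mul_smul, smul_inv_smul] at this
      simp only [this])
    (F := insert 1 ((fun y => (g y)⁻¹) '' (s : Set X)))
    ((s.finite_toSet.image _).insert 1)
  obtain ⟨y, hy, hpy⟩ := Set.mem_iUnion₂.1 (hs (Set.mem_univ (h⁻¹ • p)))
  refine hgD y _ hpy ?_
  have := hh y hy 1 (Set.mem_insert _ _) (g y)⁻¹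
    (Set.mem_insert_of_mem _ ⟨y, hy, rfl⟩)
  rw [mul_one, mul_inv_rev, inv_inv, mul_smul, if_pos hpy] at this
  by_contra hcon
  rw [if_neg hcon] at this
  exact absurd this (by decide)

end RamseyToAmenable

/-! ### Extreme amenability implies the Ramsey property -/

section AmenableToRamsey

variable {L : FirstOrder.Language.{u, v}} {M P : Type w} [L.Structure M] [L.Structure P]

theorem mem_copies_comp_equiv {N : Type w} [L.Structure N] {A : Set P} {C : Set M} {f : A → M}
    (hf : f ∈ copies L A C) (g : M ≃[L] N) {D : Set N} (hCD : ∀ c ∈ C, g c ∈ D) :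
    (fun a => g (f a)) ∈ copies L A D :=
  ⟨fun a => hCD _ (hf.1 a), (qfType_comp_equiv g f).trans hf.2⟩

/-- Automorphisms act on copies by composition. -/
instance copiesMulAction (A : Set P) :
    MulAction (Aut L M) (copies L A (Set.univ : Set M)) where
  smul g f := ⟨fun a => g (f.1 a), mem_copies_comp_equiv f.2 g fun _ _ => trivial⟩
  one_smul _ := rfl
  mul_smul _ _ _ := rfl

variable (L M) in
/-- The 2-colourings of the copies of `A` in `M` for which no copy of `B` is monochromatic. -/
def avoidingColorings (A B : Set P) : Set (copies L A (Set.univ : Set M) → Fin 2) :=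
  ⋂ g : copies L B (Set.univ : Set M), {χ | ∃ f₁ f₂ : copies L A (Set.univ : Set M),
    f₁.1 ∈ copies L A (Set.range g.1) ∧ f₂.1 ∈ copies L A (Set.range g.1) ∧ χ f₁ ≠ χ f₂}

/-- Only finitely many copies of `A` are involved in the requirement on a given copy of `B`. -/
theorem isClosed_setOf_exists_ne {A B : Set P} (hA : A.Finite) (hB : B.Finite)
    (g : copies L B (Set.univ : Set M)) :
    IsClosed {χ : copies L A (Set.univ : Set M) → Fin 2 | ∃ f₁ f₂,
      f₁.1 ∈ copies L A (Set.range g.1) ∧ f₂.1 ∈ copies L A (Set.range g.1) ∧ χ f₁ ≠ χ f₂} := by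
  have _ := hB.to_subtype
  have hfin : {f : copies L A (Set.univ : Set M) | f.1 ∈ copies L A (Set.range g.1)}.Finite :=
    (finite_copies hA (Set.finite_range g.1)).preimage Subtype.val_injective.injOn
  have heq : {χ : copies L A (Set.univ : Set M) → Fin 2 | ∃ f₁ f₂,
      f₁.1 ∈ copies L A (Set.range g.1) ∧ f₂.1 ∈ copies L A (Set.range g.1) ∧ χ f₁ ≠ χ f₂} =
      ⋃ f₁ ∈ {f : copies L A (Set.univ : Set M) | f.1 ∈ copies L A (Set.range g.1)},
      ⋃ f₂ ∈ {f : copies L A (Set.univ : Set M) | f.1 ∈ copies L A (Set.range g.1)},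
        {χ | χ f₁ ≠ χ f₂} := by
    ext χ
    simp only [Set.mem_ofPred_eq, Set.mem_iUnion, exists_prop]
    exact ⟨fun ⟨f₁, f₂, h₁, h₂, h⟩ => ⟨f₁, h₁, f₂, h₂, h⟩,
      fun ⟨f₁, h₁, f₂, h₂, h⟩ => ⟨f₁, f₂, h₁, h₂, h⟩⟩
  rw [heq]
  refine hfin.isClosed_biUnion fun f₁ _ => hfin.isClosed_biUnion fun f₂ _ => ?_
  have hc : Continuous fun χ : copies L A (Set.univ : Set M) → Fin 2 => (χ f₁, χ f₂) := by
    fun_prop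
  exact (isClosed_discrete {q : Fin 2 × Fin 2 | q.1 ≠ q.2}).preimage hc

theorem isClosed_avoidingColorings {A B : Set P} (hA : A.Finite) (hB : B.Finite) :
    IsClosed (avoidingColorings L M A B) :=
  isClosed_iInter fun g => isClosed_setOf_exists_ne hA hB g

theorem translate_mem_avoidingColorings {A B : Set P}
    {χ : copies L A (Set.univ : Set M) → Fin 2} (hχ : χ ∈ avoidingColorings L M A B)
    (k : Aut L M) : (fun f => χ (k⁻¹ • f)) ∈ avoidingColorings L M A B := by
  refine Set.mem_iInter.2 fun g => ?_
  obtain ⟨f₁, f₂, h₁, h₂, hne⟩ := Set.mem_iInter.1 hχ (k⁻¹ • g)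
  have hrange : ∀ c ∈ Set.range (k⁻¹ • g).1, k c ∈ Set.range g.1 := by
    rintro _ ⟨b, rfl⟩
    exact ⟨b, (Aut.apply_inv_self k _).symm⟩
  refine ⟨k • f₁, k • f₂, mem_copies_comp_equiv h₁ k hrange,
    mem_copies_comp_equiv h₂ k hrange, ?_⟩
  simpa only [inv_smul_smul] using hne

/-- The action of the automorphism group on colourings: `(g • χ) f = χ (g⁻¹ • f)`. -/
instance avoidingColoringsMulAction (A B : Set P) :
    MulAction (Aut L M) (avoidingColorings L M A B) where
  smul g χ := ⟨fun f => χ.1 (g⁻¹ • f), translate_mem_avoidingColorings χ.2 g⟩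
  one_smul _ := rfl
  mul_smul g h χ := Subtype.ext (funext fun f =>
    congrArg χ.1 (by rw [mul_inv_rev, mul_smul]))

theorem continuousSMul_avoidingColorings {A : Set P} (hA : A.Finite) (B : Set P) :
    ContinuousSMul (Aut L M) (avoidingColorings L M A B) := by
  have _ := hA.to_subtype
  refine ⟨continuous_induced_rng.2 (continuous_pi fun f => continuous_iff_continuousAt.2 ?_)⟩
  rintro ⟨g, χ⟩
  change Filter.Tendsto
    (fun q : Aut L M × avoidingColorings L M A B => q.2.1 (q.1⁻¹ • f)) (𝓝 (g, χ))
    (𝓝 (χ.1 (g⁻¹ • f)))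
  -- Near `g` the copy moved back by the automorphism does not change.
  have h₁ : ∀ᶠ q : Aut L M × avoidingColorings L M A B in 𝓝 (g, χ), q.1⁻¹ • f = g⁻¹ • f := by
    have : ∀ᶠ q : Aut L M × avoidingColorings L M A B in 𝓝 (g, χ),
        ∀ a, q.1⁻¹ (f.1 a) = g⁻¹ (f.1 a) :=
      Filter.eventually_all.2 fun a =>
        (continuous_fst.inv.continuousAt (x := (g, χ))).eventually
          (Aut.eventually_apply_eq (g⁻¹) (f.1 a))
    filter_upwards [this] with q hq
    exact Subtype.ext (funext hq)
  have h₂ : Continuous fun q : Aut L M × avoidingColorings L M A B => q.2.1 (g⁻¹ • f) :=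
    (continuous_apply _).comp (continuous_subtype_val.comp continuous_snd)
  refine (h₂.tendsto (g, χ)).congr' ?_
  filter_upwards [h₁] with q hq
  rw [hq]

/-- A fixed point of the action on colourings would be a constant colouring. -/
theorem IsExtremelyAmenable.avoidingColorings_eq_empty (hM : L.IsUltrahomogeneous M)
    (hG : IsExtremelyAmenable.{w, x} (Aut L M)) (e : P ↪[L] M) {A B : Set P} (hA : A.Finite)
    (hB : B.Finite) : avoidingColorings L M A B = ∅ := by
  by_contra hne
  have _ := hA.to_subtype
  have _ : Nonempty (avoidingColorings L M A B) :=
    Set.nonempty_coe_sort.2 (Set.nonempty_iff_ne_empty.2 hne)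
  have _ : CompactSpace (avoidingColorings L M A B) :=
    isCompact_iff_compactSpace.1 (isClosed_avoidingColorings hA hB).isCompact
  have _ := continuousSMul_avoidingColorings (L := L) (M := M) hA B
  have _ : ContinuousSMul (Aut L M) (ULift.{x} (avoidingColorings L M A B)) :=
    ⟨continuous_uliftUp.comp
      (continuous_fst.smul (continuous_uliftDown.comp continuous_snd))⟩
  obtain ⟨⟨χ⟩, hχ⟩ := hG (ULift.{x} (avoidingColorings L M A B))
  have hconst : ∀ f₁ f₂, χ.1 f₁ = χ.1 f₂ := by
    intro f₁ f₂
    obtain ⟨g, hg⟩ := exists_aut_of_qfType_eq hM (f₁.2.2.trans f₂.2.2.symm)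
    have h₁ : g • f₁ = f₂ := Subtype.ext (funext hg)
    have h₂ : g • χ = χ := congrArg ULift.down (hχ g)
    calc χ.1 f₁ = χ.1 (g⁻¹ • f₂) := by rw [← h₁, inv_smul_smul]
      _ = (g • χ).1 f₂ := rfl
      _ = χ.1 f₂ := by rw [h₂]
  obtain ⟨f₁, f₂, -, -, hf⟩ := Set.mem_iInter.1 χ.2
    ⟨fun b => e b, fun _ => trivial, qfType_comp_embedding e _⟩
  exact hf (hconst f₁ f₂)

theorem IsExtremelyAmenable.finitaryERP (hM : L.IsUltrahomogeneous M)
    (hG : IsExtremelyAmenable.{w, x} (Aut L M)) : FinitaryERP (L.age M) := by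
  classical
  intro P hP A B hA hB
  obtain ⟨-, ⟨e⟩⟩ := hP
  have _ := hB.to_subtype
  obtain ⟨s, hs⟩ := isCompact_univ.elim_finite_subfamily_closed _
    (fun g => isClosed_setOf_exists_ne (L := L) (M := M) hA hB g)
    ((Set.univ_inter _).trans (hG.avoidingColorings_eq_empty hM e hA hB))
  let C : Set M := ⋃ g ∈ s, Set.range g.1
  have hC : C.Finite := s.finite_toSet.biUnion fun g _ => Set.finite_range g.1
  let S : L.Substructure M := Substructure.closure L C
  have hCS : C ⊆ S := Substructure.subset_closure
  refine ⟨_, age.fg_substructure (Substructure.fg_closure hC), (Subtype.val ⁻¹' C : Set S),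
    hC.preimage Subtype.val_injective.injOn, fun χ => ?_⟩
  -- Extend `χ` by `0` to all copies of `A` in `M`.
  let χ' : copies L A (Set.univ : Set M) → Fin 2 := fun f =>
    if h : ∃ c : copies L A (Subtype.val ⁻¹' C : Set S), (fun a => (c.1 a : M)) = f.1 then
      χ h.choose else 0
  have hχ' : ∀ (c : copies L A (Subtype.val ⁻¹' C : Set S)) (f : copies L A (Set.univ : Set M)),
      (fun a => (c.1 a : M)) = f.1 → χ' f = χ c := by
    intro c f hcf
    have h : ∃ c : copies L A (Subtype.val ⁻¹' C : Set S), (fun a => (c.1 a : M)) = f.1 :=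
      ⟨c, hcf⟩
    have hc : h.choose = c := Subtype.ext (funext fun a =>
      Subtype.ext (congrFun (h.choose_spec.trans hcf.symm) a))
    simp only [χ', dif_pos h, hc]
  have hout : χ' ∉ Set.univ ∩ ⋂ g ∈ s, _ := Set.eq_empty_iff_forall_notMem.1 hs χ'
  simp only [Set.univ_inter, Set.mem_iInter, not_forall] at hout
  obtain ⟨g, hgs, hmono⟩ := hout
  have hgC : ∀ b, g.1 b ∈ C := fun b => Set.mem_biUnion hgs ⟨b, rfl⟩
  refine ⟨fun b => ⟨g.1 b, hCS (hgC b)⟩,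
    ⟨hgC, (qfType_comp_embedding S.subtype _).symm.trans g.2.2⟩, fun c₁ c₂ h₁ h₂ => ?_⟩
  have lift : ∀ c : copies L A (Subtype.val ⁻¹' C : Set S),
      c.1 ∈ copies L A (Set.range fun b => (⟨g.1 b, hCS (hgC b)⟩ : S)) →
      ∃ f : copies L A (Set.univ : Set M),
        f.1 ∈ copies L A (Set.range g.1) ∧ χ' f = χ c := by
    intro c hc
    have hqf := (qfType_comp_embedding S.subtype c.1).trans c.2.2
    refine ⟨⟨fun a => c.1 a, fun _ => trivial, hqf⟩, ⟨fun a => ?_, hqf⟩, hχ' c _ rfl⟩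
    obtain ⟨b, hb⟩ := hc.1 a
    exact ⟨b, congrArg Subtype.val hb⟩
  obtain ⟨f₁, hf₁, e₁⟩ := lift c₁ h₁
  obtain ⟨f₂, hf₂, e₂⟩ := lift c₂ h₂
  by_contra hne
  exact hmono ⟨f₁, f₂, hf₁, hf₂, by rwa [e₁, e₂]⟩

end AmenableToRamsey

end FiniteRamsey

theorem mainTheorem3 (L : FirstOrder.Language.{u, v}) (M : Type w) [L.Structure M]
    (hM : L.IsUltrahomogeneous M) :
    List.TFAE [
      FiniteRamsey.IsExtremelyAmenable.{w, x} (FiniteRamsey.Aut L M),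
      FiniteRamsey.FinitaryERP (L.age M),
      FiniteRamsey.IsFinitaryRamseyClass (L.age M)] := by
  tfae_have 1 → 2 := fun h => h.finitaryERP hM
  tfae_have 2 → 1 := fun h => h.isExtremelyAmenable hM
  tfae_have 2 → 3 := fun h =>
    ⟨FirstOrder.Language.age.hereditary M, FirstOrder.Language.age.jointEmbedding M, h⟩
  tfae_have 3 → 2 := fun h => h.finitaryERP
  tfae_finish
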